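/- Let $\mathcal{H}$ be a complex Hilbert space, let $N\geqslant 2$, and let $A_1,\ldots,A_N$ be bounded self-adjoint operators in $\mathcal{H}$ such that $A_iA_j$ is compact for any $i\neq j$. If the range $\mathrm{Ran}(A_i)=\{A_ix\mid x\in\mathcal{H}\}$ is closed for every $i=1,\ldots,N$, then the sum of ranges $$\sum_{i=1}^N \mathrm{Ran}(A_i)=\left\{\sum_{i=1}^N y_i \;\middle|\; y_i\in \mathrm{Ran}(A_i)\right\}$$ is closed in $\mathcal{H}$. -/

import Mathlib

/-!
Since `Ran Aᵢ` is closed, `Aᵢ†` is bounded below on it, while compactness of `Aᵢ† Aⱼ` makes `Aᵢ†`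
compact on every other `Ran Aⱼ`. Applying `Aᵢ†` to a sum `∑ xⱼ` with `xⱼ ∈ Ran Aⱼ` therefore
recovers `xᵢ` up to a compact error, so the summation map `S` satisfies an estimate
`‖x‖ ≤ a ‖S x‖ + b ‖K x‖` with `K` compact. Such an estimate forces `S` to have closed range
(Peetre's lemma): `K` is small on some closed subspace of finite codimension, so `S` is bounded
below there, and a closed subspace plus a finite-dimensional one is closed.
-/

open scoped NNReal InnerProduct InnerProductSpace

theorem coe_iSup_eq_setOf_sum {R M ι : Type*} [Semiring R] [AddCommMonoid M] [Module R M]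
    [Fintype ι] (p : ι → Submodule R M) :
    ((⨆ i, p i : Submodule R M) : Set M) =
      {y | ∃ z : ι → M, (∀ i, z i ∈ p i) ∧ y = ∑ i, z i} := by
  ext y
  have hy := Submodule.mem_iSup_finset_iff_exists_sum (s := Finset.univ) p y
  simp only [Finset.mem_univ, iSup_pos] at hy
  rw [SetLike.mem_coe, hy]
  exact ⟨fun ⟨z, hz⟩ => ⟨fun i => z i, fun i => (z i).2, hz.symm⟩,
    fun ⟨z, hz, hzy⟩ => ⟨fun i => ⟨z i, hz i⟩, hzy.symm⟩⟩

section CompactOperator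

variable {M₁ M₂ M₃ : Type*} [Zero M₁] [TopologicalSpace M₁] [TopologicalSpace M₂]
  [TopologicalSpace M₃]

theorem isCompactOperator_pi {ι : Type*} [Finite ι] {M : ι → Type*} [∀ i, TopologicalSpace (M i)]
    {f : ∀ i, M₁ → M i} (hf : ∀ i, IsCompactOperator (f i)) :
    IsCompactOperator fun x i => f i x := by
  choose C hC hfC using hf
  refine ⟨Set.univ.pi C, isCompact_univ_pi hC, ?_⟩
  filter_upwards [Filter.eventually_all.2 hfC] with x hx i _ using hx i

theorem isCompactOperator_of_comp_of_isOpenMap [Zero M₂] {f : M₂ → M₃} {g : M₁ → M₂}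
    (hfg : IsCompactOperator (f ∘ g)) (hg : IsOpenMap g) (hg0 : g 0 = 0) :
    IsCompactOperator f := by
  obtain ⟨C, hC, hfgC⟩ := hfg
  refine ⟨C, hC, Filter.mem_of_superset ?_ (Set.image_preimage_subset g (f ⁻¹' C))⟩
  exact hg0 ▸ hg.image_mem_nhds hfgC

end CompactOperator

section ClosedRange

variable {𝕜 E F G : Type*} [RCLike 𝕜] [NormedAddCommGroup E] [NormedSpace 𝕜 E]
  [NormedAddCommGroup F] [NormedSpace 𝕜 F] [NormedAddCommGroup G] [NormedSpace 𝕜 G]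

theorem exists_coFG_norm_domRestrict_le_of_isCompactOperator {K : E →L[𝕜] G}
    (hK : IsCompactOperator K) {ε : ℝ} (hε : 0 < ε) :
    ∃ V : Submodule 𝕜 E, IsClosed (V : Set E) ∧ V.CoFG ∧ ‖K.domRestrict V‖ ≤ ε := by
  obtain ⟨C, hC, hKC⟩ :=
    IsCompactOperator.image_closedBall_subset_compact (f := (K : E →ₗ[𝕜] G)) hK 1
  obtain ⟨t, -, ht, hCt⟩ := hC.finite_cover_balls (half_pos hε)
  -- `φ y` norms the net point `y`: where all `φ y ∘ K` vanish, `K x` close to `y` forces `y`, and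
  -- hence `K x`, to be small.
  choose φ hφ hφy using fun y : G => exists_dual_vector'' 𝕜 y
  have := ht.to_subtype
  let Φ : E →L[𝕜] t → 𝕜 := ContinuousLinearMap.pi fun y => φ y ∘L K
  refine ⟨Φ.ker, Φ.isClosed_ker, Submodule.CoFG.ker _,
    ContinuousLinearMap.opNorm_le_of_unit_norm hε.le fun ⟨x, hx⟩ hx1 => ?_⟩
  obtain ⟨y, hyt, hxy⟩ := Set.mem_iUnion₂.1 (hCt (hKC ⟨x, by simpa using hx1.le, rfl⟩))
  replace hxy : ‖K x - y‖ < ε / 2 := mem_ball_iff_norm.1 hxy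
  have hφx : φ y (K x) = 0 := congrFun hx ⟨y, hyt⟩
  have hy : ‖y‖ ≤ ‖K x - y‖ := calc
    ‖y‖ = ‖φ y (K x - y)‖ := by simp [hφx, hφy]
    _ ≤ ‖K x - y‖ := (φ y).le_of_opNorm_le_of_le (hφ y) le_rfl |>.trans_eq (one_mul _)
  calc ‖K x‖ ≤ ‖K x - y‖ + ‖y‖ := norm_le_norm_sub_add _ _
    _ ≤ ε := by linarith

theorem isClosed_range_of_norm_le_add_norm_isCompactOperator [CompleteSpace E]
    {S : E →L[𝕜] F} {K : E →L[𝕜] G} (hK : IsCompactOperator K) {a b : ℝ≥0}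
    (h : ∀ x, ‖x‖ ≤ a * ‖S x‖ + b * ‖K x‖) : IsClosed (S.range : Set F) := by
  obtain ⟨ε, hε, hbε⟩ := exists_pos_mul_lt one_half_pos (b : ℝ)
  obtain ⟨V, hV, hVfin, hKV⟩ := exists_coFG_norm_domRestrict_le_of_isCompactOperator hK hε
  have := hV.completeSpace_coe
  have hSV : AntilipschitzWith (2 * a) (S.domRestrict V) :=
    (S.domRestrict V).antilipschitz_of_bound fun x => by
      have hKx : b * ‖K x‖ ≤ 1 / 2 * ‖x‖ := calc
        b * ‖K x‖ ≤ b * (ε * ‖x‖) := by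
          gcongr
          exact (K.domRestrict V).le_of_opNorm_le hKV x
        _ ≤ 1 / 2 * ‖x‖ := by rw [← mul_assoc]; gcongr
      have hx : ‖x‖ ≤ a * ‖S x‖ + b * ‖K x‖ := h x
      change ‖x‖ ≤ (2 * a : ℝ≥0) * ‖S x‖
      push_cast
      linarith
  have hemb := hSV.isClosedEmbedding (S.domRestrict V).uniformContinuous
  exact ((S.isStrictMap_isClosed_range_iff_restrict V hV).2
    ⟨hemb.isEmbedding.isStrictMap, hemb.isClosed_range⟩).2

theorem isClosed_iSup_of_antilipschitzWith_of_isCompactOperator {ι : Type*} [Finite ι]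
    {Y : ι → Type*} [∀ i, NormedAddCommGroup (Y i)] [∀ i, NormedSpace 𝕜 (Y i)]
    (R : ι → Submodule 𝕜 F) [∀ i, CompleteSpace (R i)] (B : ∀ i, F →L[𝕜] Y i)
    (hanti : ∀ i, ∃ c, AntilipschitzWith c ((B i).domRestrict (R i)))
    (hcomp : ∀ i j, i ≠ j → IsCompactOperator ((B i).domRestrict (R j))) :
    IsClosed ((⨆ i, R i : Submodule 𝕜 F) : Set F) := by
  classical
  cases nonempty_fintype ι
  choose c hc using hanti
  let S : (∀ i, R i) →L[𝕜] F := ∑ j, (R j).subtypeL ∘L .proj j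
  let K (i : ι) : (∀ i, R i) →L[𝕜] Y i :=
    ∑ j ∈ Finset.univ.erase i, (B i).domRestrict (R j) ∘L .proj j
  have hS (x : ∀ i, R i) : S x = ∑ j, (x j : F) := by simp [S]
  have hK (i : ι) : IsCompactOperator (K i) :=
    (compactOperator (RingHom.id 𝕜) (∀ i, R i) (Y i)).sum_mem fun j hj =>
      (hcomp i j (Finset.ne_of_mem_erase hj).symm).comp_clm _
  have hBS (x : ∀ i, R i) (i : ι) : B i (x i) = B i (S x) - K i x := by
    rw [hS, ← Finset.add_sum_erase _ _ (Finset.mem_univ i), map_add, map_sum]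
    simp [K]
  have hrange : ((⨆ i, R i : Submodule 𝕜 F) : Set F) = S.range := by
    ext y
    simpa [hS] using Submodule.mem_iSup_finset_iff_exists_sum (s := Finset.univ) R y
  rw [hrange]
  let C := Finset.univ.sup c
  refine isClosed_range_of_norm_le_add_norm_isCompactOperator (K := .pi K)
    (a := C * ‖ContinuousLinearMap.pi B‖₊) (b := C) (isCompactOperator_pi hK) fun x => ?_
  refine (pi_norm_le_iff_of_nonneg (by positivity)).2 fun i => ?_
  calc ‖x i‖ ≤ c i * ‖B i (x i)‖ := (hc i).le_mul_norm (map_zero _) (x i)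
    _ ≤ C * ‖ContinuousLinearMap.pi B (S x) - ContinuousLinearMap.pi K x‖ := by
      rw [hBS]
      gcongr
      · exact Finset.le_sup (Finset.mem_univ i)
      · exact norm_le_pi_norm (ContinuousLinearMap.pi B (S x) - ContinuousLinearMap.pi K x) i
    _ ≤ C * (‖ContinuousLinearMap.pi B‖ * ‖S x‖ + ‖ContinuousLinearMap.pi K x‖) := by
      gcongr
      exact (norm_sub_le _ _).trans (by gcongr; exact ContinuousLinearMap.le_opNorm _ _)
    _ = _ := by push_cast; ring

end ClosedRange

section Adjoint

variable {𝕜 E H : Type*} [RCLike 𝕜] [NormedAddCommGroup E] [InnerProductSpace 𝕜 E]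
  [CompleteSpace E] [NormedAddCommGroup H] [InnerProductSpace 𝕜 H] [CompleteSpace H]

theorem exists_antilipschitzWith_adjoint_domRestrict_range (A : E →L[𝕜] H)
    (hA : IsClosed (A.range : Set H)) :
    ∃ c, AntilipschitzWith c (A†.domRestrict A.range) := by
  have := hA.completeSpace_coe
  obtain ⟨c, hc, hpre⟩ :=
    A.rangeRestrict.exists_preimage_norm_le (LinearMap.surjective_rangeRestrict _)
  lift c to ℝ≥0 using hc.le
  refine ⟨c, (A†.domRestrict A.range).antilipschitz_of_bound fun y => ?_⟩
  obtain ⟨x, rfl, hx⟩ := hpre y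
  set y := A x
  rcases (norm_nonneg y).eq_or_lt with hy | hy
  · exact hy.symm.trans_le (by positivity)
  refine le_of_mul_le_mul_right ?_ hy
  calc ‖y‖ * ‖y‖ = ‖⟪x, (A†) y⟫_𝕜‖ := by
        rw [ContinuousLinearMap.adjoint_inner_right, ← inner_self_re_eq_norm,
          inner_self_eq_norm_mul_norm]
    _ ≤ ‖x‖ * ‖(A†) y‖ := norm_inner_le_norm _ _
    _ ≤ c * ‖y‖ * ‖(A†) y‖ := by gcongr; exact hx
    _ = c * ‖(A†) y‖ * ‖y‖ := by ring

end Adjoint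

theorem mainTheorem4_general {𝕜 ι H : Type*} [RCLike 𝕜] [Finite ι] {E : ι → Type*}
    [∀ i, NormedAddCommGroup (E i)] [∀ i, InnerProductSpace 𝕜 (E i)] [∀ i, CompleteSpace (E i)]
    [NormedAddCommGroup H] [InnerProductSpace 𝕜 H] [CompleteSpace H] (A : ∀ i, E i →L[𝕜] H)
    (hcomp : ∀ i j, i ≠ j → IsCompactOperator ((A i)† ∘L A j))
    (hclosed : ∀ i, IsClosed ((A i).range : Set H)) :
    IsClosed ((⨆ i, (A i).range : Submodule 𝕜 H) : Set H) := by
  have (i : ι) : CompleteSpace (A i).range := (hclosed i).completeSpace_coe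
  refine isClosed_iSup_of_antilipschitzWith_of_isCompactOperator _ (fun i => (A i)†)
    (fun i => exists_antilipschitzWith_adjoint_domRestrict_range (A i) (hclosed i))
    fun i j hij => ?_
  have hopen := (A j).rangeRestrict.isOpenMap (LinearMap.surjective_rangeRestrict _)
  exact isCompactOperator_of_comp_of_isOpenMap (f := (A i)†.domRestrict (A j).range)
    (g := (A j).rangeRestrict) (hcomp i j hij) hopen (map_zero _)

theorem mainTheorem4 {H : Type*} [NormedAddCommGroup H] [InnerProductSpace ℂ H] [CompleteSpace H]
    (N : ℕ) (hN : 2 ≤ N) (A : Fin N → H →L[ℂ] H)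
    (hA : ∀ i, IsSelfAdjoint (A i))
    (hcomp : ∀ i j, i ≠ j → IsCompactOperator (A i ∘L A j))
    (hclosed : ∀ i, IsClosed (Set.range (A i))) :
    IsClosed {y : H | ∃ z : Fin N → H, (∀ i, z i ∈ Set.range (A i)) ∧ y = ∑ i, z i} := by
  have := mainTheorem4_general A (by simpa only [(hA _).adjoint_eq] using hcomp) hclosed
  rwa [coe_iSup_eq_setOf_sum] at this
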